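/- Let $M$ be a smooth $2n$-dimensional manifold (Hausdorff, without boundary), $g$ a smooth Riemannian metric, $J$ a smooth almost complex structure ($J^2=-\mathrm{Id}$) and $\kappa$ a symplectic form (a smooth closed non-degenerate $2$-form) on $M$ such that $g(v,w)=\kappa(v,Jw)$ for all tangent vectors $v,w$ at the same point; that is, $(M,g,J,\kappa)$ is an almost Kähler manifold. Let $\nabla$ be the Levi-Civita connection of $g$ and put, for vector fields $X,Y,Z,W$, $$B(X,Y)=J(\nabla_XJ)Y-(\nabla_{JX}J)Y,\qquad L(X,Y,Z,W)=g\big((\nabla_XB)(Y,Z),W\big),$$ where $(\nabla_XJ)Y=\nabla_X(JY)-J\nabla_XY$ and $(\nabla_XB)(Y,Z)=\nabla_X(B(Y,Z))-B(\nabla_XY,Z)-B(Y,\nabla_XZ)$; extend $L$ complex multilinearly to complex vector fields (smooth sections of $TM\otimes\mathbb C$). A complex vector field $Z$ is of type $(1,0)$ if $JZ=iZ$. If $$L(\overline{Z_i},Z_i,Z_j,\overline{Z_j})=0\quad\text{on } M$$ for all smooth complex vector fields $Z_i,Z_j$ of type $(1,0)$ on $M$, then $(M,g,J,\kappa)$ is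 a Kähler manifold; that is, $J$ is integrable: the Nijenhuis tensor $N_J(X,Y)=[JX,JY]-J[JX,Y]-J[X,JY]-[X,Y]$ vanishes. -/

import Mathlib

open Bundle VectorField
open scoped Manifold ContDiff

noncomputable section

namespace AlmostKahler

/- `M` is a smooth manifold without boundary modelled on the real vector space `E`.  Where a
Riemannian metric `g` on `M` is needed it is given by Mathlib's class `RiemannianBundle` on the
tangent bundle, so that `g x v w` is `inner ℝ v w` for `v w : TangentSpace 𝓘(ℝ, E) x`. -/
variable {E : Type*} [NormedAddCommGroup E] [NormedSpace ℝ E]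
  {M : Type*} [TopologicalSpace M] [ChartedSpace E M]

variable (E M) in
/-- Real vector fields on `M` (no regularity). -/
abbrev VField : Type _ := Π x : M, TangentSpace 𝓘(ℝ, E) x

variable (E M) in
/-- Fields of endomorphisms of the tangent bundle of `M` (no regularity). -/
abbrev EndField : Type _ := Π x : M, TangentSpace 𝓘(ℝ, E) x →L[ℝ] TangentSpace 𝓘(ℝ, E) x

variable (E M) in
/-- Fields of real bilinear forms on the tangent spaces of `M` (no regularity). -/
abbrev BilinField : Type _ :=
  Π x : M, TangentSpace 𝓘(ℝ, E) x →L[ℝ] TangentSpace 𝓘(ℝ, E) x →L[ℝ] ℝ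

/-- The vector field `J X`. -/
def EndField.app (J : EndField E M) (X : VField E M) : VField E M := fun x => J x (X x)

/-- Smooth vector fields. -/
def SmoothVField [IsManifold 𝓘(ℝ, E) ∞ M] (X : VField E M) : Prop :=
  ContMDiff 𝓘(ℝ, E) (𝓘(ℝ, E).prod 𝓘(ℝ, E)) ∞
    (fun x => TotalSpace.mk' E (E := (TangentSpace 𝓘(ℝ, E) : M → Type _)) x (X x))

/-- Smooth sections of `End(TM)`. -/
def SmoothEndField [IsManifold 𝓘(ℝ, E) ∞ M] (J : EndField E M) : Prop :=
  ContMDiff 𝓘(ℝ, E) (𝓘(ℝ, E).prod 𝓘(ℝ, E →L[ℝ] E)) ∞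
    (fun x => TotalSpace.mk' (E →L[ℝ] E)
      (E := fun x : M => TangentSpace 𝓘(ℝ, E) x →L[ℝ] TangentSpace 𝓘(ℝ, E) x) x (J x))

/-- Smooth sections of the bundle of bilinear forms on `TM`. -/
def SmoothBilinField [IsManifold 𝓘(ℝ, E) ∞ M] (κ : BilinField E M) : Prop :=
  ContMDiff 𝓘(ℝ, E) (𝓘(ℝ, E).prod 𝓘(ℝ, E →L[ℝ] E →L[ℝ] ℝ)) ∞
    (fun x => TotalSpace.mk' (E →L[ℝ] E →L[ℝ] ℝ)
      (E := fun x : M => TangentSpace 𝓘(ℝ, E) x →L[ℝ] TangentSpace 𝓘(ℝ, E) x →L[ℝ] ℝ) x (κ x))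

/-- The derivative `X f` of a real function `f` along the vector field `X`. -/
def dirDeriv (X : VField E M) (f : M → ℝ) (x : M) : ℝ :=
  mvfderiv 𝓘(ℝ, E) f x (X x)

/-- The exterior derivative of a 2-form, evaluated on vector fields:
`dκ(X,Y,Z) = X κ(Y,Z) - Y κ(X,Z) + Z κ(X,Y) - κ([X,Y],Z) + κ([X,Z],Y) - κ([Y,Z],X)`. -/
def extDerivTwo (κ : BilinField E M) (X Y Z : VField E M) (x : M) : ℝ :=
  dirDeriv X (fun y => κ y (Y y) (Z y)) x
    - dirDeriv Y (fun y => κ y (X y) (Z y)) x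
    + dirDeriv Z (fun y => κ y (X y) (Y y)) x
    - κ x (mlieBracket 𝓘(ℝ, E) X Y x) (Z x)
    + κ x (mlieBracket 𝓘(ℝ, E) X Z x) (Y x)
    - κ x (mlieBracket 𝓘(ℝ, E) Y Z x) (X x)

/-- `κ` is a symplectic structure: a smooth, closed, non-degenerate 2-form. -/
structure IsSymplectic [IsManifold 𝓘(ℝ, E) ∞ M] (κ : BilinField E M) : Prop where
  smooth : SmoothBilinField κ
  alternating : ∀ (x : M) (v : TangentSpace 𝓘(ℝ, E) x), κ x v v = 0
  nondegenerate : ∀ (x : M) (v : TangentSpace 𝓘(ℝ, E) x), (∀ w, κ x v w = 0) → v = 0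
  closed : ∀ X Y Z : VField E M, SmoothVField X → SmoothVField Y → SmoothVField Z →
    ∀ x, extDerivTwo κ X Y Z x = 0

/-- `J` is an almost complex structure: a smooth section of `End(TM)` with `J² = -Id`. -/
structure IsAlmostComplex [IsManifold 𝓘(ℝ, E) ∞ M] (J : EndField E M) : Prop where
  smooth : SmoothEndField J
  sq : ∀ (x : M) (v : TangentSpace 𝓘(ℝ, E) x), J x (J x v) = -v

/-- The Nijenhuis tensor `N_J(X,Y) = [JX,JY] - J[JX,Y] - J[X,JY] - [X,Y]`. -/
def nijenhuis (J : EndField E M) (X Y : VField E M) : VField E M :=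
  mlieBracket 𝓘(ℝ, E) (J.app X) (J.app Y) - J.app (mlieBracket 𝓘(ℝ, E) (J.app X) Y)
    - J.app (mlieBracket 𝓘(ℝ, E) X (J.app Y)) - mlieBracket 𝓘(ℝ, E) X Y

/-- An almost complex structure is integrable if its Nijenhuis tensor vanishes. -/
def IsIntegrable [IsManifold 𝓘(ℝ, E) ∞ M] (J : EndField E M) : Prop :=
  ∀ X Y : VField E M, SmoothVField X → SmoothVField Y → nijenhuis J X Y = 0

/-- `(M, g, J, κ)` is an almost Kähler manifold: `κ` is symplectic, `J` is an almost complex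
structure, and `κ(·, J ·)` is the Riemannian metric `g` of `M`.  (`J`-invariance of `g`, that is
that `g` is Hermitian, is then automatic: `g(Jv,Jw) = κ(Jv,-w) = κ(w,Jv) = g(w,v) = g(v,w)`.) -/
structure IsAlmostKahler [IsManifold 𝓘(ℝ, E) ∞ M]
    [RiemannianBundle (fun x : M => TangentSpace 𝓘(ℝ, E) x)]
    (J : EndField E M) (κ : BilinField E M) : Prop where
  symplectic : IsSymplectic κ
  almostComplex : IsAlmostComplex J
  calibrated : ∀ (x : M) (v w : TangentSpace 𝓘(ℝ, E) x), inner ℝ v w = κ x v (J x w)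

/-- `(M, g, J, κ)` is a Kähler manifold: almost Kähler with `J` integrable. -/
structure IsKahler [IsManifold 𝓘(ℝ, E) ∞ M]
    [RiemannianBundle (fun x : M => TangentSpace 𝓘(ℝ, E) x)]
    (J : EndField E M) (κ : BilinField E M) : Prop where
  almostKahler : IsAlmostKahler J κ
  integrable : IsIntegrable J

/-! ### The Levi-Civita connection and the tensors `∇J`, `B`, `∇B`, `L` -/

section Connection

variable [IsManifold 𝓘(ℝ, E) ∞ M]

variable (E M) in
/-- Affine connections on `M`: Mathlib's covariant derivatives on the tangent bundle.
`nab Y x (X x)` is `(∇_X Y)(x)`. -/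
abbrev Connection : Type _ :=
  CovariantDerivative 𝓘(ℝ, E) E (TangentSpace 𝓘(ℝ, E) : M → Type _)

/-- The vector field `∇_X Y`. -/
def covDeriv (nab : Connection E M) (X Y : VField E M) : VField E M := fun x => nab Y x (X x)

/-- `nab` is the Levi-Civita connection of the Riemannian metric of `M`: the affine connection
(mapping smooth vector fields to smooth vector fields) which is compatible with the metric,
`X g(Y,Z) = g(∇_X Y, Z) + g(Y, ∇_X Z)`, and torsion free, `∇_X Y - ∇_Y X = [X,Y]`. -/
structure IsLeviCivita [RiemannianBundle (fun x : M => TangentSpace 𝓘(ℝ, E) x)]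
    (nab : Connection E M) : Prop where
  smooth : ∀ X Y : VField E M, SmoothVField X → SmoothVField Y →
    SmoothVField (covDeriv nab X Y)
  metric : ∀ X Y Z : VField E M, SmoothVField X → SmoothVField Y → SmoothVField Z → ∀ x,
    dirDeriv X (fun y => inner ℝ (Y y) (Z y)) x =
      inner ℝ (covDeriv nab X Y x) (Z x) + inner ℝ (Y x) (covDeriv nab X Z x)
  torsionFree : ∀ X Y : VField E M, SmoothVField X → SmoothVField Y →
    covDeriv nab X Y - covDeriv nab Y X = mlieBracket 𝓘(ℝ, E) X Y

variable (nab : Connection E M) (J : EndField E M)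

/-- `(∇_X J) Y = ∇_X (J Y) - J (∇_X Y)`. -/
def nablaJ (X Y : VField E M) : VField E M :=
  covDeriv nab X (J.app Y) - J.app (covDeriv nab X Y)

/-- `B(X,Y) = J (∇_X J) Y - (∇_{JX} J) Y`. -/
def tensorB (X Y : VField E M) : VField E M :=
  J.app (nablaJ nab J X Y) - nablaJ nab J (J.app X) Y

/-- `(∇_X B)(Y,Z) = ∇_X (B(Y,Z)) - B(∇_X Y, Z) - B(Y, ∇_X Z)`. -/
def nablaB (X Y Z : VField E M) : VField E M :=
  covDeriv nab X (tensorB nab J Y Z) - tensorB nab J (covDeriv nab X Y) Z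
    - tensorB nab J Y (covDeriv nab X Z)

/-- `L(X,Y,Z,W) = g((∇_X B)(Y,Z), W)`, on real vector fields. -/
def tensorL [RiemannianBundle (fun x : M => TangentSpace 𝓘(ℝ, E) x)]
    (X Y Z W : VField E M) (x : M) : ℝ :=
  inner ℝ (nablaB nab J X Y Z x) (W x)

end Connection

/-! ### Complex vector fields -/

variable (E M) in
/-- Complex vector fields `Z = X + iY`, i.e. sections of `TM ⊗ ℂ = TM ⊕ i TM`
(no regularity). -/
@[ext]
structure CVField where
  /-- the real part `X` of `X + iY` -/
  re : VField E M
  /-- the imaginary part `Y` of `X + iY` -/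
  im : VField E M

namespace CVField

/-- The complex conjugate `X - iY` of `X + iY`. -/
def conj (Z : CVField E M) : CVField E M := ⟨Z.re, -Z.im⟩

/-- `Z = part 0 + i • part 1`. -/
def part (Z : CVField E M) : Fin 2 → VField E M := ![Z.re, Z.im]

/-- Smooth complex vector fields. -/
def Smooth [IsManifold 𝓘(ℝ, E) ∞ M] (Z : CVField E M) : Prop :=
  SmoothVField Z.re ∧ SmoothVField Z.im

/-- The action of `J`, extended complex linearly to `TM ⊗ ℂ`. -/
def applyJ (J : EndField E M) (Z : CVField E M) : CVField E M := ⟨J.app Z.re, J.app Z.im⟩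

/-- Multiplication by the imaginary unit: `i (X + iY) = -Y + iX`. -/
def mulI (Z : CVField E M) : CVField E M := ⟨-Z.im, Z.re⟩

/-- `Z` is of type `(1,0)`: it lies in the `i`-eigenspace of `J`. -/
def IsType10 (J : EndField E M) (Z : CVField E M) : Prop := Z.applyJ J = Z.mulI

end CVField

/-- The complex multilinear extension of `L` to complex vector fields:
the sum of `i^(a+b+c+d) L(X_a, Y_b, Z_c, W_d)` over `a b c d ∈ {0,1}`, where a complex vector
field `X` is written `X_0 + i X_1`. -/
def tensorLC [IsManifold 𝓘(ℝ, E) ∞ M]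
    [RiemannianBundle (fun x : M => TangentSpace 𝓘(ℝ, E) x)]
    (nab : Connection E M) (J : EndField E M)
    (X Y Z W : CVField E M) (x : M) : ℂ :=
  ∑ a : Fin 2, ∑ b : Fin 2, ∑ c : Fin 2, ∑ d : Fin 2,
    Complex.I ^ (a.val + b.val + c.val + d.val) *
      (tensorL nab J (X.part a) (Y.part b) (Z.part c) (W.part d) x : ℂ)

end AlmostKahler

end

namespace AlmostKahler

section App

variable {E : Type*} [NormedAddCommGroup E] [NormedSpace ℝ E]
  {M : Type*} [TopologicalSpace M] [ChartedSpace E M] {J : EndField E M} {X Y : VField E M}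

/-! Write `B` for `tensorB`. Algebraically `B` pairs two (1,0) vectors to a (0,1) vector. Pairing
`∇B` with a conjugate (1,0) field selects its (1,0) part, which a derivative of `B` alone cannot
produce: it comes only from the derivative of `J`, and `nablaB_projection` computes it as `J (∇_U J)
B(V,W)` up to a factor. With `U` conjugate to `V`, the two occurrences of `∇J` recombine into a
second `B`. So the hypothesis says `g(B(X,B(X,Y)),Y) = 0`, and by skewness of `B(X,·)`
(`inner_tensorB`) this is `-|B(X,Y)|²`. Hence `B = 0`. Closedness of `κ` gives `∇_{JX}J = -J ∇_X J`
(`nablaJ_app_left`), so `B = 2J∇J`. Thus `∇J = 0`, and torsion-freeness makes the Nijenhuis tensor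
vanish. -/

lemma app_apply (x : M) : J.app X x = J x (X x) := rfl

lemma app_add : J.app (X + Y) = J.app X + J.app Y := by
  funext x; exact map_add (J x) _ _

lemma app_neg : J.app (-X) = -J.app X := by
  funext x; exact map_neg (J x) _

end App

variable {E : Type*} [NormedAddCommGroup E] [NormedSpace ℝ E]
  {M : Type*} [TopologicalSpace M] [ChartedSpace E M] [IsManifold 𝓘(ℝ, E) ∞ M]
  {J : EndField E M} {nab : Connection E M} {X Y Z U V W : VField E M}

section Smooth

lemma SmoothVField.add (hX : SmoothVField X) (hY : SmoothVField Y) : SmoothVField (X + Y) :=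
  ContMDiff.add_section hX hY

lemma SmoothVField.neg (hX : SmoothVField X) : SmoothVField (-X) :=
  ContMDiff.neg_section hX

lemma SmoothVField.sub (hX : SmoothVField X) (hY : SmoothVField Y) : SmoothVField (X - Y) :=
  ContMDiff.sub_section hX hY

lemma SmoothVField.mdifferentiableAt (hX : SmoothVField X) (x : M) :
    MDifferentiableAt 𝓘(ℝ, E) (𝓘(ℝ, E).prod 𝓘(ℝ, E))
      (fun x => TotalSpace.mk' E (E := (TangentSpace 𝓘(ℝ, E) : M → Type _)) x (X x)) x :=
  (ContMDiff.mdifferentiable hX (by simp)) x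

lemma SmoothVField.app (hJ : SmoothEndField J) (hX : SmoothVField X) :
    SmoothVField (J.app X) :=
  ContMDiff.clm_bundle_apply hJ hX

end Smooth

/-! ### Algebraic identities for `∇J` and `B` -/

section Linear

lemma app_app (hJ : IsAlmostComplex J) : J.app (J.app X) = -X :=
  funext fun x => hJ.sq x (X x)

lemma covDeriv_add (hY : SmoothVField Y) (hZ : SmoothVField Z) :
    covDeriv nab X (Y + Z) = covDeriv nab X Y + covDeriv nab X Z := by
  funext x
  have h := nab.isCovariantDerivativeOnUniv.add (hY.mdifferentiableAt x) (hZ.mdifferentiableAt x)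
  exact congrArg (fun f => f (X x)) h

lemma covDeriv_zero : covDeriv nab X (0 : VField E M) = 0 := by
  funext x
  simp [covDeriv]

lemma covDeriv_neg (hY : SmoothVField Y) : covDeriv nab X (-Y) = -covDeriv nab X Y := by
  rw [eq_neg_iff_add_eq_zero, ← covDeriv_add hY.neg hY, neg_add_cancel, covDeriv_zero]

lemma covDeriv_neg_left : covDeriv nab (-X) Y = -covDeriv nab X Y := by
  funext x; exact map_neg (nab Y x) _

lemma nablaJ_add (hJ : SmoothEndField J) (hY : SmoothVField Y) (hZ : SmoothVField Z) :
    nablaJ nab J X (Y + Z) = nablaJ nab J X Y + nablaJ nab J X Z := by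
  simp only [nablaJ, app_add, covDeriv_add hY hZ, covDeriv_add (hY.app hJ) (hZ.app hJ)]
  abel

lemma nablaJ_neg (hJ : SmoothEndField J) (hY : SmoothVField Y) :
    nablaJ nab J X (-Y) = -nablaJ nab J X Y := by
  simp only [nablaJ, app_neg, covDeriv_neg hY, covDeriv_neg (hY.app hJ)]
  abel

lemma nablaJ_neg_left : nablaJ nab J (-X) Y = -nablaJ nab J X Y := by
  simp only [nablaJ, app_neg, covDeriv_neg_left]
  abel

lemma covDeriv_app : covDeriv nab X (J.app Y) = nablaJ nab J X Y + J.app (covDeriv nab X Y) := by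
  simp [nablaJ]

/-- `∇_X J` anticommutes with `J`. -/
lemma nablaJ_app (hJ : IsAlmostComplex J) (hY : SmoothVField Y) :
    nablaJ nab J X (J.app Y) = -J.app (nablaJ nab J X Y) := by
  -- This is the derivative of `J² = -1`, in Leibniz form.
  have h : J.app (nablaJ nab J X Y) + J.app (J.app (covDeriv nab X Y))
      = J.app (covDeriv nab X (J.app Y)) := by
    rw [← app_add, covDeriv_app]
  rw [app_app hJ] at h
  simp only [nablaJ] at h ⊢
  rw [app_app hJ, covDeriv_neg hY, ← h]
  abel

lemma tensorB_add (hJ : SmoothEndField J) (hY : SmoothVField Y) (hZ : SmoothVField Z) :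
    tensorB nab J X (Y + Z) = tensorB nab J X Y + tensorB nab J X Z := by
  simp only [tensorB, nablaJ_add hJ hY hZ, app_add]
  abel

lemma tensorB_neg (hJ : SmoothEndField J) (hY : SmoothVField Y) :
    tensorB nab J X (-Y) = -tensorB nab J X Y := by
  simp only [tensorB, nablaJ_neg hJ hY, app_neg]
  abel

lemma tensorB_neg_left : tensorB nab J (-X) Y = -tensorB nab J X Y := by
  simp only [tensorB, app_neg, nablaJ_neg_left]
  abel

lemma tensorB_app (hJ : IsAlmostComplex J) (hY : SmoothVField Y) :
    tensorB nab J X (J.app Y) = -J.app (tensorB nab J X Y) := by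
  simp only [tensorB, nablaJ_app hJ hY, sub_eq_add_neg, app_add, app_neg]
  abel

lemma tensorB_app_left (hJ : IsAlmostComplex J) :
    tensorB nab J (J.app X) Y = -J.app (tensorB nab J X Y) := by
  simp only [tensorB, sub_eq_add_neg, app_add, app_neg, app_app hJ, nablaJ_neg_left]
  abel

end Linear

/-! ### The derivative of `B` -/

variable [RiemannianBundle (fun x : M => TangentSpace 𝓘(ℝ, E) x)]

lemma SmoothVField.nablaJ (hJ : SmoothEndField J) (hLC : IsLeviCivita nab)
    (hX : SmoothVField X) (hY : SmoothVField Y) : SmoothVField (nablaJ nab J X Y) :=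
  (hLC.smooth _ _ hX (hY.app hJ)).sub ((hLC.smooth _ _ hX hY).app hJ)

lemma SmoothVField.tensorB (hJ : SmoothEndField J) (hLC : IsLeviCivita nab)
    (hX : SmoothVField X) (hY : SmoothVField Y) : SmoothVField (tensorB nab J X Y) :=
  ((hX.nablaJ hJ hLC hY).app hJ).sub ((hX.app hJ).nablaJ hJ hLC hY)

lemma nablaB_neg_left (hJ : SmoothEndField J) (hLC : IsLeviCivita nab)
    (hU : SmoothVField U) (hW : SmoothVField W) :
    nablaB nab J (-U) V W = -nablaB nab J U V W := by
  simp only [nablaB, covDeriv_neg_left, tensorB_neg_left, tensorB_neg hJ (hLC.smooth _ _ hU hW)]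
  abel

/-- The covariant derivative of the identity `B(V, JW) = -J B(V, W)`. -/
lemma nablaB_app (hJ : IsAlmostComplex J) (hLC : IsLeviCivita nab)
    (hU : SmoothVField U) (hV : SmoothVField V) (hW : SmoothVField W) :
    nablaB nab J U V (J.app W) = -J.app (nablaB nab J U V W)
      - nablaJ nab J U (tensorB nab J V W) - tensorB nab J V (nablaJ nab J U W) := by
  have hB := hV.tensorB hJ.smooth hLC hW
  have hUW := hLC.smooth _ _ hU hW
  simp only [nablaB, tensorB_app hJ hW, covDeriv_neg (hB.app hJ.smooth), covDeriv_app,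
    tensorB_add hJ.smooth (hU.nablaJ hJ.smooth hLC hW) (hUW.app hJ.smooth),
    tensorB_app hJ hUW, sub_eq_add_neg, app_add, app_neg]
  abel

/-- The component of `∇_U B` on which only the derivative of `J` contributes. -/
lemma nablaB_projection (hJ : IsAlmostComplex J) (hLC : IsLeviCivita nab)
    (hU : SmoothVField U) (hV : SmoothVField V) (hW : SmoothVField W) :
    nablaB nab J U V W - J.app (nablaB nab J U V (J.app W))
      - J.app (nablaB nab J U (J.app V) W) - nablaB nab J U (J.app V) (J.app W)
      = 2 • J.app (nablaJ nab J U (tensorB nab J V W)) := by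
  have hB := hV.tensorB hJ.smooth hLC hW
  -- The terms `B(V, (∇_U J)W)` from the two expansions cancel because `B(JV,·) = -J B(V,·)`; the
  -- `∇_U J` terms add up because `∇_U J` anticommutes with `J`.
  rw [nablaB_app hJ hLC hU hV hW, nablaB_app hJ hLC hU (hV.app hJ.smooth) hW,
    tensorB_app_left hJ, tensorB_app_left hJ, nablaJ_neg hJ.smooth (hB.app hJ.smooth),
    nablaJ_app hJ hB]
  simp only [sub_eq_add_neg, app_add, app_neg, app_app hJ]
  abel

/-! ### Consequences of the metric and of `dκ = 0` -/

section Kahler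

variable {κ : BilinField E M}

lemma IsAlmostKahler.inner_app_app (h : IsAlmostKahler J κ) (x : M)
    (v w : TangentSpace 𝓘(ℝ, E) x) : inner ℝ (J x v) (J x w) = inner ℝ v w := by
  have hκ : ∀ a b : TangentSpace 𝓘(ℝ, E) x, κ x a b = -κ x b a := by
    intro a b
    have h0 := h.symplectic.alternating x (a + b)
    simp only [map_add, add_apply, h.symplectic.alternating] at h0
    linarith
  rw [h.calibrated, h.almostComplex.sq, map_neg, ← hκ, ← h.calibrated, real_inner_comm]

lemma IsAlmostKahler.inner_app_left (h : IsAlmostKahler J κ) (x : M)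
    (v w : TangentSpace 𝓘(ℝ, E) x) : inner ℝ (J x v) w = -inner ℝ v (J x w) := by
  rw [← h.inner_app_app x v, h.almostComplex.sq, inner_neg_right, neg_neg]

lemma IsAlmostKahler.form_eq (h : IsAlmostKahler J κ) (x : M)
    (v w : TangentSpace 𝓘(ℝ, E) x) : κ x v w = inner ℝ (J x v) w := by
  rw [h.inner_app_left, h.calibrated, h.almostComplex.sq, map_neg, neg_neg]

/-- `∇_X J` is skew-symmetric. -/
lemma inner_nablaJ (h : IsAlmostKahler J κ) (hLC : IsLeviCivita nab)
    (hX : SmoothVField X) (hY : SmoothVField Y) (hZ : SmoothVField Z) (x : M) :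
    inner ℝ (nablaJ nab J X Y x) (Z x) = -inner ℝ (Y x) (nablaJ nab J X Z x) := by
  have hJ := h.almostComplex
  have h1 := hLC.metric X Y (J.app Z) hX hY (hZ.app hJ.smooth) x
  have h2 := hLC.metric X (J.app Y) Z hX (hY.app hJ.smooth) hZ x
  have h3 : (fun y => (inner ℝ (J.app Y y) (Z y) : ℝ))
      = -fun y => inner ℝ (Y y) (J.app Z y) := by
    funext y; exact h.inner_app_left y _ _
  have h4 : dirDeriv X (-fun y => (inner ℝ (Y y) (J.app Z y) : ℝ)) x
      = -dirDeriv X (fun y => (inner ℝ (Y y) (J.app Z y) : ℝ)) x := by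
    simp [dirDeriv, mvfderiv_neg]
  rw [h3, h4, h1] at h2
  simp only [covDeriv_app, Pi.add_apply, inner_add_left, inner_add_right, app_apply,
    h.inner_app_left] at h2
  linarith

/-- `J` and `∇_X J` are skew and anticommute, so their product is skew too. -/
lemma inner_tensorB (h : IsAlmostKahler J κ) (hLC : IsLeviCivita nab)
    (hX : SmoothVField X) (hY : SmoothVField Y) (hZ : SmoothVField Z) (x : M) :
    inner ℝ (tensorB nab J X Y x) (Z x) = -inner ℝ (Y x) (tensorB nab J X Z x) := by
  have hJ := h.almostComplex
  have h1 := inner_nablaJ h hLC (hX.app hJ.smooth) hY hZ x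
  have h2 := inner_nablaJ h hLC hX hY (hZ.app hJ.smooth) x
  rw [nablaJ_app hJ hZ] at h2
  simp only [tensorB, Pi.sub_apply, Pi.neg_apply, inner_sub_left, inner_sub_right, app_apply,
    inner_neg_right, h.inner_app_left] at h1 h2 ⊢
  linarith

/-- The fundamental form is closed: the cyclic sum of `g((∇_X J)Y, Z)` vanishes. -/
lemma inner_nablaJ_cyclic (h : IsAlmostKahler J κ) (hLC : IsLeviCivita nab)
    (hX : SmoothVField X) (hY : SmoothVField Y) (hZ : SmoothVField Z) (x : M) :
    inner ℝ (nablaJ nab J X Y x) (Z x) + inner ℝ (nablaJ nab J Y Z x) (X x)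
      + inner ℝ (nablaJ nab J Z X x) (Y x) = 0 := by
  have hJ := h.almostComplex.smooth
  have hc := h.symplectic.closed X Y Z hX hY hZ x
  have hκ : ∀ V W : VField E M,
      (fun y => κ y (V y) (W y)) = fun y => (inner ℝ (J.app V y) (W y) : ℝ) :=
    fun V W => funext fun y => h.form_eq y _ _
  have hs := inner_nablaJ h hLC hY hX hZ x
  rw [real_inner_comm] at hs
  simp only [extDerivTwo, hκ, hLC.metric X _ _ hX (hY.app hJ) hZ,
    hLC.metric Y _ _ hY (hX.app hJ) hZ, hLC.metric Z _ _ hZ (hX.app hJ) hY,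
    ← hLC.torsionFree X Y hX hY, ← hLC.torsionFree X Z hX hZ, ← hLC.torsionFree Y Z hY hZ] at hc
  simp only [h.form_eq, covDeriv_app, Pi.add_apply, Pi.sub_apply, inner_add_left,
    map_sub, sub_apply, app_apply, h.inner_app_left] at hc
  have hf : ∀ v w : TangentSpace 𝓘(ℝ, E) x, inner ℝ v (J x w) = -(inner ℝ w (J x v) : ℝ) :=
    fun v w => by rw [← h.inner_app_left, real_inner_comm]
  have h1 := hf (Y x) (covDeriv nab X Z x)
  have h2 := hf (X x) (covDeriv nab Y Z x)
  have h3 := hf (X x) (covDeriv nab Z Y x)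
  have h4 := real_inner_comm (nablaJ nab J Y X x) (Z x)
  have h5 := real_inner_comm (nablaJ nab J Y Z x) (X x)
  linarith

/-- An almost Kähler manifold is quasi-Kähler. -/
lemma nablaJ_app_left (h : IsAlmostKahler J κ) (hLC : IsLeviCivita nab)
    (hX : SmoothVField X) (hY : SmoothVField Y) :
    nablaJ nab J (J.app X) Y = -J.app (nablaJ nab J X Y) := by
  have hJ := h.almostComplex
  have hX' := hX.app hJ.smooth
  have hY' := hY.app hJ.smooth
  have key : ∀ Z : VField E M, SmoothVField Z → ∀ x,
      inner ℝ (nablaJ nab J (J.app X) (J.app Y) x + nablaJ nab J X Y x) (Z x) = 0 := by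
    intro Z hZ x
    have hZ' := hZ.app hJ.smooth
    -- In `h0 + h1 - h2 + h3` everything cancels except twice the goal.
    have h0 := inner_nablaJ_cyclic h hLC hX hY hZ x
    have h1 := inner_nablaJ_cyclic h hLC hX' hY' hZ x
    have h2 := inner_nablaJ_cyclic h hLC hX hY' hZ' x
    have h3 := inner_nablaJ_cyclic h hLC hX' hY hZ' x
    simp only [nablaJ_app hJ hX, nablaJ_app hJ hY, nablaJ_app hJ hZ, Pi.neg_apply, inner_add_left,
      inner_neg_left, inner_neg_right, app_apply, h.inner_app_left, hJ.sq, neg_neg]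
      at h0 h1 h2 h3 ⊢
    linarith
  have hz : nablaJ nab J (J.app X) (J.app Y) + nablaJ nab J X Y = 0 := by
    funext x
    exact inner_self_eq_zero.1
      (key _ ((hX'.nablaJ hJ.smooth hLC hY').add (hX.nablaJ hJ.smooth hLC hY)) x)
  rw [nablaJ_app hJ hY, neg_add_eq_zero] at hz
  rw [← hz, app_app hJ, neg_neg]

/-! ### Vanishing of `B`, `∇J` and the Nijenhuis tensor -/

lemma tensorB_eq_zero (h : IsAlmostKahler J κ) (hLC : IsLeviCivita nab)
    (hL : ∀ Zi Zj : CVField E M, Zi.Smooth → Zj.Smooth → Zi.IsType10 J → Zj.IsType10 J →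
      ∀ x : M, tensorLC nab J Zi.conj Zi Zj Zj.conj x = 0)
    (hX : SmoothVField X) (hY : SmoothVField Y) : tensorB nab J X Y = 0 := by
  have hJ := h.almostComplex
  have hX' := hX.app hJ.smooth
  have hY' := hY.app hJ.smooth
  have hB := hX.tensorB hJ.smooth hLC hY
  -- `JV + iV = i(V - iJV)`.
  have htype : ∀ V : VField E M, (⟨J.app V, V⟩ : CVField E M).IsType10 J := fun V => by
    simp [CVField.IsType10, CVField.applyJ, CVField.mulI, app_app hJ]
  funext x
  have hre := congrArg Complex.re
    (hL ⟨J.app X, X⟩ ⟨J.app Y, Y⟩ ⟨hX', hX⟩ ⟨hY', hY⟩ (htype X) (htype Y) x)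
  have hI3 : Complex.I ^ 3 = -Complex.I := by simp [pow_succ]
  simp [tensorLC, Fin.sum_univ_two, CVField.conj, CVField.part, tensorL,
    nablaB_neg_left hJ.smooth hLC hX hY, nablaB_neg_left hJ.smooth hLC hX hY', hI3] at hre
  -- The real part in `hre` is the left side of `hP` minus that of `hQ`. The right sides differ by
  -- `2 g(B(X,B(X,Y)),Y)`, since `g(Jv,JY) = g(v,Y)`.
  have hP := congrArg (fun v => (inner ℝ v (Y x) : ℝ))
    (congrFun (nablaB_projection hJ hLC hX hX hY) x)
  have hQ := congrArg (fun v => (inner ℝ v (J x (Y x)) : ℝ))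
    (congrFun (nablaB_projection hJ hLC hX' hX hY) x)
  have hskew := inner_tensorB h hLC hX hB hY x
  -- Only the outer `B` of `B(X,B(X,Y))` is unfolded, to match `hP` and `hQ`.
  rw [tensorB] at hskew
  simp only [Pi.sub_apply, two_smul, Pi.add_apply, inner_sub_left, inner_add_left, app_apply,
    h.inner_app_left, hJ.sq, inner_neg_right, neg_neg] at hre hP hQ hskew
  have hnorm : (inner ℝ (tensorB nab J X Y x) (tensorB nab J X Y x) : ℝ) = 0 := by linarith
  exact inner_self_eq_zero.1 hnorm

lemma nablaJ_eq_zero (h : IsAlmostKahler J κ) (hLC : IsLeviCivita nab)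
    (hL : ∀ Zi Zj : CVField E M, Zi.Smooth → Zj.Smooth → Zi.IsType10 J → Zj.IsType10 J →
      ∀ x : M, tensorLC nab J Zi.conj Zi Zj Zj.conj x = 0)
    (hX : SmoothVField X) (hY : SmoothVField Y) : nablaJ nab J X Y = 0 := by
  have hB := tensorB_eq_zero h hLC hL hX hY
  rw [tensorB, nablaJ_app_left h hLC hX hY, sub_neg_eq_add] at hB
  funext x
  have h2 := congrArg (J x) (congrFun hB x)
  simp only [Pi.add_apply, Pi.zero_apply, app_apply, map_add, h.almostComplex.sq, map_zero] at h2
  rw [← neg_add, neg_eq_zero, ← two_smul ℝ, smul_eq_zero] at h2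
  exact h2.resolve_left two_ne_zero

/-- Brackets are differences of covariant derivatives; once `J` is parallel it moves out of them and
`J² = -1` cancels all terms. -/
lemma nijenhuis_eq_zero (hLC : IsLeviCivita nab) (hJ : IsAlmostComplex J)
    (h : ∀ X Y : VField E M, SmoothVField X → SmoothVField Y → nablaJ nab J X Y = 0)
    (hX : SmoothVField X) (hY : SmoothVField Y) : nijenhuis J X Y = 0 := by
  have hX' := hX.app hJ.smooth
  have hY' := hY.app hJ.smooth
  have hd : ∀ V W : VField E M, SmoothVField V → SmoothVField W →
      covDeriv nab V (J.app W) = J.app (covDeriv nab V W) := fun V W hV hW => by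
    rw [covDeriv_app, h V W hV hW, zero_add]
  simp only [nijenhuis, ← hLC.torsionFree _ _ hX' hY', ← hLC.torsionFree _ _ hX' hY,
    ← hLC.torsionFree _ _ hX hY', ← hLC.torsionFree _ _ hX hY, hd _ _ hX' hY, hd _ _ hY' hX,
    hd _ _ hX hY, hd _ _ hY hX, sub_eq_add_neg, app_add, app_neg, app_app hJ]
  abel

end Kahler

end AlmostKahler

open AlmostKahler in
theorem proposition3p6 (n : ℕ)
    (M : Type*) [TopologicalSpace M] [T2Space M]
    [ChartedSpace (EuclideanSpace ℝ (Fin (2 * n))) M]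
    [IsManifold 𝓘(ℝ, EuclideanSpace ℝ (Fin (2 * n))) ∞ M]
    [RiemannianBundle (fun x : M => TangentSpace 𝓘(ℝ, EuclideanSpace ℝ (Fin (2 * n))) x)]
    [IsContMDiffRiemannianBundle 𝓘(ℝ, EuclideanSpace ℝ (Fin (2 * n))) ∞
      (EuclideanSpace ℝ (Fin (2 * n)))
      (fun x : M => TangentSpace 𝓘(ℝ, EuclideanSpace ℝ (Fin (2 * n))) x)]
    (J : EndField (EuclideanSpace ℝ (Fin (2 * n))) M)
    (κ : BilinField (EuclideanSpace ℝ (Fin (2 * n))) M)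
    (hAK : IsAlmostKahler J κ)
    (nab : Connection (EuclideanSpace ℝ (Fin (2 * n))) M)
    (hLC : IsLeviCivita nab)
    (hL : ∀ Zi Zj : CVField (EuclideanSpace ℝ (Fin (2 * n))) M,
      Zi.Smooth → Zj.Smooth → Zi.IsType10 J → Zj.IsType10 J →
      ∀ x : M, tensorLC nab J Zi.conj Zi Zj Zj.conj x = 0) :
    IsKahler J κ := by
  have hA : ∀ X Y : VField (EuclideanSpace ℝ (Fin (2 * n))) M, SmoothVField X → SmoothVField Y →
      nablaJ nab J X Y = 0 := fun X Y hX hY => nablaJ_eq_zero hAK hLC hL hX hY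
  exact ⟨hAK, fun X Y hX hY => nijenhuis_eq_zero hLC hAK.almostComplex hA hX hY⟩
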